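/- Let $H$ be a Hilbert space and let $\alpha\ge 0$ satisfy $\alpha+\alpha^{2}+\alpha^{3}<1$. A nonempty closed set $P\subset H$ is called $\alpha$-paraconvex if $\operatorname{dist}(q,P)\le \alpha r$ for every $r>0$, every open ball $D\subset H$ of radius $r$ and every $q\in\operatorname{conv}(P\cap D)$. Let $\mathrm{bexp}_\alpha(H)$ be the family of all bounded $\alpha$-paraconvex subsets of $H$, endowed with the Hausdorff metric, and let $C_b(H,H)$ be the space of all bounded continuous maps $H\to H$ with the supremum metric. Theorem 3.0. Let $X$ be a paracompact space and let $F:X\to \mathrm{bexp}_\alpha(H)$ be continuous. Then there exists a continuous map $\mathfrak{F}:X\to C_b(H,H)$ such that for every $x\in X$ the map $\mathfrak{F}_x:H\to H$ is a continuous retraction of $H$ onto the set $F(x)$. -/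

import Mathlib

open Set TopologicalSpace
open scoped BoundedContinuousFunction

/-- A subset `P` of a real normed space is `α`-paraconvex if it is nonempty and closed and if, for
every open ball `D` of radius `r > 0`, each point `q` of the convex hull of `P ∩ D` satisfies
`dist (q, P) ≤ α * r`. -/
def IsParaconvex {B : Type*} [NormedAddCommGroup B] [NormedSpace ℝ B] (α : ℝ) (P : Set B) : Prop :=
  P.Nonempty ∧ IsClosed P ∧
    ∀ (c : B) (r : ℝ), 0 < r →
      ∀ q ∈ convexHull ℝ (P ∩ Metric.ball c r), Metric.infDist q P ≤ α * r

/-- The family of all bounded `α`-paraconvex subsets of `B`. As a subspace of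
`TopologicalSpace.Closeds B`, whose distance is `Metric.hausdorffEDist`, it carries the Hausdorff
metric (which is finite on nonempty bounded sets). -/
def bexp {B : Type*} [NormedAddCommGroup B] [NormedSpace ℝ B] (α : ℝ) : Set (Closeds B) :=
  {P | Bornology.IsBounded (P : Set B) ∧ IsParaconvex α (P : Set B)}

/-- The map `R : B → B` takes values in `A` and fixes every point of `A`. For continuous `R` this
says that `R` is a continuous retraction of `B` onto `A`. -/
def IsRetractionOnto {B : Type*} (R : B → B) (A : Set B) : Prop :=
  (∀ y, R y ∈ A) ∧ ∀ y ∈ A, R y = y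

open Filter Topology Metric

/-! Newton-like iteration. Suppose `f a` is a retraction onto `P a` up to error `r`. For each `y`,
average points of `P a` lying about `r`-close to `f a y`: by paraconvexity the average is about `α *
r`-close to `P a`, so the error shrinks by any chosen factor `γ` in `(α, 1)` while the map moves by
at most `2 * r`. The averages are made continuous by partitions of unity, over `E` and then over the
parameters. Starting from the zero map, the corrections are dominated by a geometric series, and the
limit has error zero. -/

/-- A set-valued map is Hausdorff continuous if the distance functions to its values vary
continuously, uniformly over the whole space. -/
def HausdorffContinuous {Y E : Type*} [TopologicalSpace Y] [PseudoMetricSpace E]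
    (P : Y → Set E) : Prop :=
  ∀ a, ∀ ε > 0, ∀ᶠ b in 𝓝 a, ∀ y,
    infDist y (P b) < infDist y (P a) + ε ∧ infDist y (P a) < infDist y (P b) + ε

theorem hausdorffContinuous_bexp {B : Type*} [NormedAddCommGroup B] [NormedSpace ℝ B] (α : ℝ) :
    HausdorffContinuous (fun A : bexp (B := B) α => ((A : Closeds B) : Set B)) := by
  intro a ε hε
  filter_upwards [Metric.eball_mem_nhds a (ENNReal.ofReal_pos.2 hε)] with b hb y
  have hfin : hausdorffEDist ((b : Closeds B) : Set B) ((a : Closeds B) : Set B) ≠ ⊤ :=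
    hausdorffEDist_ne_top_of_nonempty_of_bounded b.2.2.1 a.2.2.1 b.2.1 a.2.1
  have hlt : hausdorffDist ((b : Closeds B) : Set B) ((a : Closeds B) : Set B) < ε := by
    have h : hausdorffEDist ((b : Closeds B) : Set B) ((a : Closeds B) : Set B)
        < ENNReal.ofReal ε := hb
    exact (ENNReal.lt_ofReal_iff_toReal_lt hfin).1 h
  have h₁ := infDist_le_infDist_add_hausdorffDist (x := y) hfin
  have h₂ := infDist_le_infDist_add_hausdorffDist (x := y) (hausdorffEDist_comm.trans_ne hfin)
  rw [hausdorffDist_comm] at h₂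
  exact ⟨by linarith, by linarith⟩

/-- Thickenings of convex sets are convex, so averaging points `δ`-near `P` costs only `δ`. This
absorbs the change of `P a` with `a`. -/
theorem IsParaconvex.infDist_le_of_mem_convexHull {B : Type*} [NormedAddCommGroup B]
    [NormedSpace ℝ B] {α : ℝ} {P : Set B} (hP : IsParaconvex α P) {c q : B} {r δ : ℝ}
    (hr : 0 < r) (hδ : 0 < δ) (hq : q ∈ convexHull ℝ {z | infDist z P < δ ∧ dist z c < r}) :
    infDist q P ≤ α * (r + δ) + δ := by
  have hsub : {z | infDist z P < δ ∧ dist z c < r} ⊆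
      thickening δ (convexHull ℝ (P ∩ ball c (r + δ))) := by
    rintro z ⟨hz, hzc⟩
    obtain ⟨p, hp, hzp⟩ := (infDist_lt_iff hP.1).1 hz
    refine mem_thickening_iff.2 ⟨p, subset_convexHull ℝ _ ⟨hp, ?_⟩, hzp⟩
    rw [mem_ball]
    have := dist_triangle_left p c z
    linarith
  obtain ⟨p, hp, hqp⟩ := mem_thickening_iff.1
    (convexHull_min hsub ((convex_convexHull ℝ _).thickening δ) hq)
  have h₁ := hP.2.2 c (r + δ) (by linarith) p hp
  have h₂ := infDist_le_infDist_add_dist (s := P) (x := q) (y := p)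
  linarith

/-- Given a map `f` that is nearly a retraction onto `P`, there is a map close to `f` whose values
are convex combinations of points of `P` near the values of `f`, and, close to `P`, near the
argument. -/
theorem exists_boundedContinuous_mem_convexHull {E : Type*} [NormedAddCommGroup E]
    [NormedSpace ℝ E] {P : Set E} (hP : P.Nonempty) (f : E →ᵇ E) {r R θ : ℝ}
    (hθ : 0 < θ) (hrR : r < R) (hθr : 4 * θ ≤ r) (hf : ∀ y, infDist (f y) P ≤ r)
    (hfθ : ∀ y, infDist y P < 2 * θ → dist (f y) y ≤ r / 2) :
    ∃ g : E →ᵇ E, ∀ y, g y ∈ convexHull ℝ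
      {z | z ∈ P ∧ dist z (f y) < R ∧ (infDist y P ≤ 3 / 2 * θ → dist z y < 2 * θ)} := by
  obtain ⟨g, hg⟩ := exists_continuous_forall_mem_convex_of_local_const
    (t := fun y => convexHull ℝ
      {z | z ∈ P ∧ dist z (f y) < R ∧ (infDist y P ≤ 3 / 2 * θ → dist z y < 2 * θ)})
    (fun y => convex_convexHull ℝ _) (by
      intro y₀
      have key : ∃ z ∈ P, dist z (f y₀) < R ∧ (infDist y₀ P < 2 * θ → dist z y₀ < 2 * θ) := by
        by_cases h : infDist y₀ P < 2 * θ
        · obtain ⟨z, hz, hyz⟩ := (infDist_lt_iff hP).1 h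
          rw [dist_comm] at hyz
          refine ⟨z, hz, ?_, fun _ => hyz⟩
          have h₁ := dist_triangle_right z (f y₀) y₀
          have h₂ := hfθ y₀ h
          linarith
        · obtain ⟨z, hz, hyz⟩ := (infDist_lt_iff hP).1 ((hf y₀).trans_lt hrR)
          exact ⟨z, hz, by rwa [dist_comm], fun h' => absurd h' h⟩
      obtain ⟨z, hz, hzR, hzθ⟩ := key
      refine ⟨z, ?_⟩
      have e₁ : ∀ᶠ y in 𝓝 y₀, dist z (f y) < R :=
        (continuous_const.dist f.continuous).continuousAt.eventually_lt continuousAt_const hzR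
      -- The gap between `3 / 2 * θ` and `2 * θ` makes this condition stable under moving `y`.
      have e₂ : ∀ᶠ y in 𝓝 y₀, infDist y P ≤ 3 / 2 * θ → dist z y < 2 * θ := by
        by_cases h : infDist y₀ P < 2 * θ
        · filter_upwards [(continuous_const.dist continuous_id).continuousAt.eventually_lt
            continuousAt_const (hzθ h)] with y hy _ using hy
        · have h' : 3 / 2 * θ < infDist y₀ P := by linarith
          filter_upwards [continuousAt_const.eventually_lt
            (continuous_infDist_pt P).continuousAt h'] with y hy hy'
          exact absurd hy' (not_le.2 hy)
      filter_upwards [e₁, e₂] with y h₁ h₂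
      exact subset_convexHull ℝ _ ⟨hz, h₁, h₂⟩)
  have hgf : ∀ y, dist (g y) (f y) < R := fun y =>
    convexHull_min (fun z hz => hz.2.1) (convex_ball (f y) R) (hg y)
  refine ⟨BoundedContinuousFunction.ofNormedAddCommGroup g g.continuous (R + ‖f‖) ?_, hg⟩
  intro y
  have h₁ := hgf y
  rw [dist_eq_norm] at h₁
  have h₂ := norm_le_norm_add_norm_sub' (g y) (f y)
  have h₃ := f.norm_coe_le_norm y
  linarith

/-- A Hausdorff continuous, family of bounded sets admits a continuous strict bound
on the norms of its points. -/
theorem HausdorffContinuous.exists_continuous_norm_lt {Y E : Type*} [TopologicalSpace Y]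
    [NormalSpace Y] [ParacompactSpace Y] [SeminormedAddCommGroup E] {P : Y → Set E} (hPc : HausdorffContinuous P) (hne : ∀ a, (P a).Nonempty)
    (hb : ∀ a, Bornology.IsBounded (P a)) :
    ∃ ρ : C(Y, ℝ), ∀ a, ∀ p ∈ P a, ‖p‖ < ρ a := by
  refine exists_continuous_forall_mem_convex_of_local_const
    (t := fun a => {s : ℝ | ∀ p ∈ P a, ‖p‖ < s}) (fun a => ?_) (fun a => ?_)
  · have : {s : ℝ | ∀ p ∈ P a, ‖p‖ < s} = ⋂ p ∈ P a, Ioi ‖p‖ := by ext; simp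
    rw [this]
    exact convex_iInter₂ fun p _ => convex_Ioi _
  · obtain ⟨C, hC⟩ := (hb a).exists_norm_le
    refine ⟨C + 1, ?_⟩
    filter_upwards [hPc a 1 one_pos] with b hab p hp
    have h := (hab p).2
    rw [infDist_zero_of_mem hp, zero_add] at h
    obtain ⟨q, hq, hpq⟩ := (infDist_lt_iff (hne a)).1 h
    rw [dist_eq_norm] at hpq
    have := norm_le_norm_add_norm_sub' p q
    linarith [hC q hq]

section Family

variable {Y E : Type*} [TopologicalSpace Y] [NormedAddCommGroup E] [NormedSpace ℝ E]

/-- `f a` is a retraction onto `P a` up to an error `r a`. -/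
def IsApproxRetraction (P : Y → Set E) (r : Y → ℝ) (f : Y → E →ᵇ E) : Prop :=
  (∀ a y, infDist (f a y) (P a) ≤ r a) ∧
    ∃ θ > 0, ∀ a y, infDist y (P a) < θ → dist (f a y) y ≤ r a / 2

theorem IsApproxRetraction.exists_improvement [NormalSpace Y] [ParacompactSpace Y] {α γ m : ℝ}
    (hα : 0 ≤ α) (hαγ : α < γ) (hγ : γ < 1) (hm : 0 < m) {P : Y → Set E}
    (hP : ∀ a, IsParaconvex α (P a)) (hPc : HausdorffContinuous P) {r : Y → ℝ}
    (hr : Continuous r) (hmr : ∀ a, m ≤ r a) {f : Y → E →ᵇ E} (hf : Continuous f)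
    (hfP : IsApproxRetraction P r f) :
    ∃ g : Y → E →ᵇ E, Continuous g ∧ IsApproxRetraction P (fun a => γ * r a) g ∧
      ∀ a, dist (f a) (g a) ≤ 2 * r a := by
  obtain ⟨hfr, θ₀, hθ₀, hfθ⟩ := hfP
  have hγ₀ : 0 < γ := hα.trans_lt hαγ
  have hrpos : ∀ a, 0 < r a := fun a => hm.trans_le (hmr a)
  -- Ball radius `(1 + 2 * κ) * r` plus thickening `κ * r` gives the factor `1 + 3 * κ`.
  obtain ⟨κ, hκ, hκα, hκ₁⟩ : ∃ κ > 0, α * (1 + 3 * κ) + κ ≤ γ ∧ 1 + 2 * κ ≤ 2 := by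
    refine ⟨(γ - α) / 4, by linarith, ?_, by linarith⟩
    nlinarith
  -- The uniform lower bound `m` on `r` lets one `θ` serve all `a`.
  set θ := min (θ₀ / 2) (γ * m / 8) with hθdef
  have hθ : 0 < θ := lt_min (by linarith) (by positivity)
  have hθ₁ : 2 * θ ≤ θ₀ := by linarith [min_le_left (θ₀ / 2) (γ * m / 8)]
  have hθ₂ : ∀ a, 8 * θ ≤ γ * r a := fun a => by
    have h₁ := min_le_right (θ₀ / 2) (γ * m / 8)
    have h₂ := mul_le_mul_of_nonneg_left (hmr a) hγ₀.le
    linarith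
  let S : Y → E → Set E := fun a y =>
    {z | (infDist z (P a) < κ * r a ∧ dist z (f a y) < (1 + 2 * κ) * r a) ∧
      (infDist y (P a) < θ → dist z y < γ * r a / 2)}
  obtain ⟨g, hg⟩ := exists_continuous_forall_mem_convex_of_local_const
    (t := fun a => {g : E →ᵇ E | ∀ y, g y ∈ convexHull ℝ (S a y)})
    (by
      intro a g₁ h₁ g₂ h₂ s t hs ht hst y
      exact convex_convexHull ℝ (S a y) (h₁ y) (h₂ y) hs ht hst)
    (by
      intro a
      obtain ⟨g, hg⟩ := exists_boundedContinuous_mem_convexHull (hP a).1 (f a)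
        (R := (1 + κ) * r a) hθ (by nlinarith [hrpos a]) (by nlinarith [hrpos a, hθ₂ a])
        (hfr a) (fun y hy => hfθ a y (hy.trans_le hθ₁))
      refine ⟨g, ?_⟩
      have e₁ : ∀ᶠ b in 𝓝 a, κ * r a / 2 < κ * r b :=
        continuousAt_const.eventually_lt (continuous_const.mul hr).continuousAt
          (by nlinarith [mul_pos hκ (hrpos a)])
      have e₂ : ∀ᶠ b in 𝓝 a, (1 + κ) * r a + dist (f a) (f b) < (1 + 2 * κ) * r b :=
        (continuous_const.add (continuous_const.dist hf)).continuousAt.eventually_lt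
          (continuous_const.mul hr).continuousAt
          (by simp only [Pi.add_apply, dist_self]; nlinarith [mul_pos hκ (hrpos a)])
      filter_upwards [e₁, e₂, hPc a (κ * r a / 2) (by have := hrpos a; positivity),
        hPc a (θ / 2) (by linarith)] with b h₁ h₂ h₃ h₄ y
      refine convexHull_mono ?_ (hg y)
      rintro z ⟨hzP, hzf, hzy⟩
      refine ⟨⟨?_, ?_⟩, fun hy => ?_⟩
      · have := (h₃ z).1
        rw [infDist_zero_of_mem hzP] at this
        linarith
      · have h₅ := dist_triangle z (f a y) (f b y)
        have h₆ := BoundedContinuousFunction.dist_coe_le_dist (f := f a) (g := f b) y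
        linarith
      · have h₅ := hzy (by linarith [(h₄ y).2])
        linarith [hθ₂ b])
  refine ⟨g, g.continuous, ⟨fun a y => ?_, θ, hθ, fun a y hy => ?_⟩, fun a => ?_⟩
  · have h₁ : g a y ∈ convexHull ℝ
        {z | infDist z (P a) < κ * r a ∧ dist z (f a y) < (1 + 2 * κ) * r a} :=
      convexHull_mono (fun z hz => hz.1) (hg a y)
    have h₂ := (hP a).infDist_le_of_mem_convexHull (by have := hrpos a; positivity)
      (mul_pos hκ (hrpos a)) h₁
    have h₃ := mul_le_mul_of_nonneg_right hκα (hrpos a).le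
    linarith
  · exact (convexHull_min (fun z hz => hz.2 hy) (convex_ball y (γ * r a / 2)) (hg a y)).le
  · rw [BoundedContinuousFunction.dist_le (by linarith [hrpos a])]
    intro y
    have h₁ : dist (g a y) (f a y) < (1 + 2 * κ) * r a :=
      convexHull_min (fun z hz => hz.1.2) (convex_ball (f a y) _) (hg a y)
    rw [dist_comm]
    exact h₁.le.trans (mul_le_mul_of_nonneg_right hκ₁ (hrpos a).le)

/-- Retractions onto the values of a Hausdorff continuous family of bounded `α`-paraconvex sets,
`α < 1`, can be chosen continuously in the sup metric. -/
theorem HausdorffContinuous.exists_continuous_retraction [CompleteSpace E] [NormalSpace Y]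
    [ParacompactSpace Y] {α : ℝ} (hα₀ : 0 ≤ α) (hα₁ : α < 1) {P : Y → Set E}
    (hPc : HausdorffContinuous P) (hP : ∀ a, IsParaconvex α (P a))
    (hb : ∀ a, Bornology.IsBounded (P a)) :
    ∃ Φ : Y → E →ᵇ E, Continuous Φ ∧ ∀ a, IsRetractionOnto (Φ a) (P a) := by
  obtain ⟨γ, hαγ, hγ₁⟩ := exists_between hα₁
  have hγ₀ : 0 < γ := hα₀.trans_lt hαγ
  obtain ⟨ρ₀, hρ₀⟩ := hPc.exists_continuous_norm_lt (fun a => (hP a).1) hb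
  have hρ₀pos : ∀ a, 0 < ρ₀ a := fun a => by
    obtain ⟨p, hp⟩ := (hP a).1
    exact (norm_nonneg p).trans_lt (hρ₀ a p hp)
  -- Points within `1` of `P a` have norm below `ρ₀ a + 1`, which must be at most half the initial
  -- error.
  let ρ : Y → ℝ := fun a => 2 * (ρ₀ a + 1)
  have hρc : Continuous ρ := continuous_const.mul (ρ₀.continuous.add continuous_const)
  have hρ₁ : ∀ a, 1 ≤ ρ a := fun a => by
    have := hρ₀pos a
    simp only [ρ]; linarith
  let T : ℕ → Type _ := fun n =>
    {f : Y → E →ᵇ E // Continuous f ∧ IsApproxRetraction P (fun a => γ ^ n * ρ a) f}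
  have step : ∀ n (f : T n), ∃ g : T (n + 1), ∀ a, dist (f.1 a) (g.1 a) ≤ 2 * (γ ^ n * ρ a) := by
    rintro n ⟨f, hf, hfP⟩
    obtain ⟨g, hg, hgP, hfg⟩ := hfP.exists_improvement hα₀ hαγ hγ₁ (pow_pos hγ₀ n) hP hPc
      (continuous_const.mul hρc)
      (fun a => le_mul_of_one_le_right (pow_pos hγ₀ n).le (hρ₁ a)) hf
    refine ⟨⟨g, hg, ?_⟩, hfg⟩
    convert hgP using 2 with a
    simp only [Pi.mul_apply]
    ring
  have init : IsApproxRetraction P (fun a => γ ^ 0 * ρ a) (fun _ => (0 : E →ᵇ E)) := by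
    refine ⟨fun a y => ?_, 1, one_pos, fun a y hy => ?_⟩
    · obtain ⟨p, hp⟩ := (hP a).1
      have h := infDist_le_dist_of_mem (x := (0 : E)) hp
      rw [dist_zero_left] at h
      have := hρ₀ a p hp
      have := hρ₀pos a
      simp only [BoundedContinuousFunction.coe_zero, Pi.zero_apply, pow_zero, one_mul, ρ]
      linarith
    · obtain ⟨p, hp, hyp⟩ := (infDist_lt_iff (hP a).1).1 hy
      rw [dist_eq_norm] at hyp
      have := norm_le_norm_add_norm_sub' y p
      have := hρ₀ a p hp
      simp only [BoundedContinuousFunction.coe_zero, Pi.zero_apply, pow_zero, one_mul, ρ,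
        dist_zero_left]
      linarith
  choose next hnext using step
  let F : ∀ n, T n := fun n => Nat.rec ⟨fun _ => 0, continuous_const, init⟩ next n
  have hF : ∀ n a, dist ((F n).1 a) ((F (n + 1)).1 a) ≤ 2 * ρ a * γ ^ n := fun n a =>
    (hnext n (F n) a).trans_eq (by ring)
  have hlim : ∀ a, ∃ g, Tendsto (fun n => (F n).1 a) atTop (𝓝 g) := fun a =>
    cauchySeq_tendsto_of_complete (cauchySeq_of_le_geometric γ (2 * ρ a) hγ₁ fun n => hF n a)
  choose Φ hΦ using hlim
  have hdist : ∀ n a, dist ((F n).1 a) (Φ a) ≤ 2 * ρ a * γ ^ n / (1 - γ) := fun n a =>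
    dist_le_of_le_geometric_of_tendsto γ (2 * ρ a) hγ₁ (fun n => hF n a) (hΦ a) n
  have hgeom : ∀ c : ℝ, Tendsto (fun n : ℕ => γ ^ n * c) atTop (𝓝 0) := fun c => by
    simpa using (tendsto_pow_atTop_nhds_zero_of_lt_one hγ₀.le hγ₁).mul_const c
  have hΦy : ∀ a y, Tendsto (fun n => (F n).1 a y) atTop (𝓝 (Φ a y)) := fun a y =>
    (BoundedContinuousFunction.tendsto_iff_tendstoUniformly.1 (hΦ a)).tendsto_at y
  refine ⟨Φ, ?_, fun a => ⟨fun y => ?_, fun y hy => ?_⟩⟩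
  -- The geometric bound is uniform wherever `ρ` is bounded, hence locally.
  · have hunif : TendstoLocallyUniformly (fun n a => (F n).1 a) Φ atTop := by
      rw [Metric.tendstoLocallyUniformly_iff]
      intro ε hε a
      refine ⟨{b | ρ b < ρ a + 1}, hρc.continuousAt.eventually_lt continuousAt_const
        (lt_add_one _), ?_⟩
      filter_upwards [(hgeom (2 * (ρ a + 1) / (1 - γ))).eventually_lt_const hε] with n hn b hb
      rw [dist_comm]
      refine ((hdist n b).trans ?_).trans_lt hn
      have h₁ : 0 < 1 - γ := by linarith
      have h₂ : ρ b ≤ ρ a + 1 := le_of_lt hb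
      calc 2 * ρ b * γ ^ n / (1 - γ) ≤ 2 * (ρ a + 1) * γ ^ n / (1 - γ) := by gcongr
        _ = γ ^ n * (2 * (ρ a + 1) / (1 - γ)) := by ring
    exact hunif.continuous (Eventually.frequently (Eventually.of_forall fun n => (F n).2.1))
  · rw [← (hP a).2.1.closure_eq, mem_closure_iff_infDist_zero (hP a).1]
    refine le_antisymm ?_ infDist_nonneg
    exact le_of_tendsto_of_tendsto'
      (((continuous_infDist_pt (P a)).tendsto _).comp (hΦy a y)) (hgeom (ρ a))
      fun n => (F n).2.2.1 a y
  · refine dist_le_zero.1 (le_of_tendsto_of_tendsto' ((hΦy a y).dist tendsto_const_nhds)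
      (hgeom (ρ a / 2)) fun n => ?_)
    obtain ⟨θ, hθ, h⟩ := (F n).2.2.2
    exact (h a y (by rwa [infDist_zero_of_mem hy])).trans_eq (by ring)

end Family

theorem theorem3p0 {X H : Type*} [TopologicalSpace X] [ParacompactSpace X]
    [NormedAddCommGroup H] [InnerProductSpace ℝ H] [CompleteSpace H]
    (α : ℝ) (hα₀ : 0 ≤ α) (hα : α + α ^ 2 + α ^ 3 < 1)
    (F : X → bexp (B := H) α) (hF : Continuous F) :
    ∃ Φ : X → (H →ᵇ H), Continuous Φ ∧
      ∀ x, IsRetractionOnto (Φ x) ((F x : Closeds H) : Set H) := by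
  have hα₁ : α < 1 := by
    have := pow_nonneg hα₀ 3
    nlinarith [sq_nonneg α]
  -- The parameter space is `bexp α` itself, whose metric makes it normal and paracompact; no
  -- separation of `X` is needed.
  obtain ⟨Φ, hΦ, hret⟩ := (hausdorffContinuous_bexp (B := H) α).exists_continuous_retraction
    hα₀ hα₁ (fun A => A.2.2) (fun A => A.2.1)
  exact ⟨Φ ∘ F, hΦ.comp hF, fun x => hret (F x)⟩
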